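/- A Heyting semilattice is a set $H$ with a constant $1$ and binary operations $\wedge,\Rightarrow$ satisfying $1\wedge x=x$, $x\wedge x=x$, $x\wedge y=y\wedge x$, $x\wedge(y\wedge z)=(x\wedge y)\wedge z$, $x\Rightarrow x=1$, $x\wedge(x\Rightarrow y)=x\wedge y$, $y\wedge(x\Rightarrow y)=y$ and $x\Rightarrow(y\wedge z)=(x\Rightarrow y)\wedge(x\Rightarrow z)$; $\mathsf{HSLat}$ is the category of Heyting semilattices and maps preserving $1,\wedge,\Rightarrow$. A category is semi-abelian if it is pointed, Barr exact, protomodular and has binary coproducts. In such a category a monomorphism is normal if it is the kernel of some morphism; subobjects $x\colon X\to A$, $y\colon Y\to A$ cooperate if there is $\varphi\colon X\times Y\to A$ with $\varphi(1_X,0)=x$ and $\varphi(0,1_Y)=y$; the centraliser of $X$ in $A$ is the largest subobject of $A$ cooperating with $X$; the normaliser of $X$ in $A$ is the largest subobject of $A$ that contains $X$ and in which $X$ is normal. A semi-abelian category $\mathcal C$ is action accessible if, for every object $X$, each object of the category of split extensions with kernel $X$ (morphisms being the identity on $X$ and commuting with projections and sections) admits a morphism to a subterminal object of that category, i.e. to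 an object that receives at most one morphism from each object. Theorem. (1) The category $\mathsf{HSLat}$ is not action accessible. (2) Let $C_4=\{0<1<2<3\}$ be the four-element chain and $A=C_4\times C_4$, as Heyting semilattices (so that $3$ and $(3,3)$ play the role of $1$). The normaliser in $A$ of the subobject $X=\{(2,2),(3,3)\}$ does not exist. (3) In every semi-abelian category that is action accessible, centralisers of normal monomorphisms exist and are normal. This implication is strict: $\mathsf{HSLat}$ is a semi-abelian category in which centralisers of normal monomorphisms exist and are normal, but it is not action accessible. -/

import Mathlib

open CategoryTheory CategoryTheory.Limits

universe u v w

/-! ### Categorical notions -/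

namespace SemiAb

variable {C : Type v} [Category.{w} C]

/-- Protomodularity: for every `v : E ⟶ B` the change-of-base functor
`v* : Pt_B(C) ⥤ Pt_E(C)` between categories of points (split epimorphisms with a chosen section),
given by pulling back along `v`, reflects isomorphisms.
Here `f` is a morphism of points `(A, α, β) ⟶ (A', α', β')` over `B`, the objects `P`, `P'` are the
pullbacks of `α`, `α'` along `v`, and `g` is the induced morphism `v* f` (it commutes with the
induced sections automatically). -/
def Protomodular (C : Type v) [Category.{w} C] : Prop :=
  ∀ ⦃E B A A' P P' : C⦄ (v : E ⟶ B)
    (α : A ⟶ B) (β : B ⟶ A) (α' : A' ⟶ B) (β' : B ⟶ A') (f : A ⟶ A')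
    (p : P ⟶ A) (q : P ⟶ E) (p' : P' ⟶ A') (q' : P' ⟶ E) (g : P ⟶ P'),
    β ≫ α = 𝟙 B → β' ≫ α' = 𝟙 B → f ≫ α' = α → β ≫ f = β' →
    IsPullback p q α v → IsPullback p' q' α' v →
    g ≫ p' = p ≫ f → g ≫ q' = q →
    IsIso g → IsIso f

/-- Semi-abelian categories: pointed, Barr exact (regular, and every internal equivalence relation
is effective), protomodular, with binary coproducts. -/
structure IsSemiAbelian (C : Type v) [Category.{w} C] : Prop where
  hasZeroObject : HasZeroObject C
  regular : Regular C
  effective : ∀ ⦃R X : C⦄ (r₁ r₂ : R ⟶ X),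
    IsEquivalenceRelation r₁ r₂ → IsEffectiveEquivalenceRelation r₁ r₂
  protomodular : Protomodular C
  hasBinaryCoproducts : HasBinaryCoproducts C

variable [HasZeroMorphisms C]

/-- `k` is a kernel of `f`. -/
def IsKernelOf {K A B : C} (k : K ⟶ A) (f : A ⟶ B) : Prop :=
  ∃ h : k ≫ f = 0, Nonempty (IsLimit (KernelFork.ofι k h))

/-- A normal monomorphism: a kernel of some morphism. -/
def IsNormal {K A : C} (k : K ⟶ A) : Prop :=
  ∃ (B : C) (f : A ⟶ B), IsKernelOf k f

/-- `x` and `y` Huq-commute: there is `φ : X × Y ⟶ A` with `(1, 0) ≫ φ = x` and `(0, 1) ≫ φ = y`.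
Here `P`, with projections `p`, `q`, is a product of `X` and `Y`, and `i = (1, 0)`,
`j = (0, 1)`. -/
def Cooperate {X Y A : C} (x : X ⟶ A) (y : Y ⟶ A) : Prop :=
  ∃ (P : C) (p : P ⟶ X) (q : P ⟶ Y) (i : X ⟶ P) (j : Y ⟶ P) (φ : P ⟶ A),
    Nonempty (IsLimit (BinaryFan.mk p q)) ∧
    i ≫ p = 𝟙 X ∧ i ≫ q = 0 ∧ j ≫ p = 0 ∧ j ≫ q = 𝟙 Y ∧
    i ≫ φ = x ∧ j ≫ φ = y

/-- `z : Z ⟶ A` is the centraliser of `x : X ⟶ A`: the largest subobject of `A` which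
cooperates with `x`. -/
def IsCentraliser {X Z A : C} (x : X ⟶ A) (z : Z ⟶ A) : Prop :=
  Mono z ∧ Cooperate x z ∧
    ∀ ⦃Y : C⦄ (y : Y ⟶ A), Mono y → Cooperate x y → ∃ h : Y ⟶ Z, h ≫ z = y

/-- Centralisers of normal monomorphisms exist and are normal monomorphisms. -/
def HasNormalCentralisers (C : Type v) [Category.{w} C] [HasZeroMorphisms C] : Prop :=
  ∀ ⦃X A : C⦄ (x : X ⟶ A), IsNormal x →
    (∃ (Z : C) (z : Z ⟶ A), IsCentraliser x z) ∧
    ∀ (Z : C) (z : Z ⟶ A), IsCentraliser x z → IsNormal z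

/-- `X ⟶ N ⟶ A` is a normaliser of `x : X ⟶ A`: the terminal factorisation of `x` as a normal
monomorphism `n` followed by a monomorphism `m`, that is, the largest subobject of `A` in which
`X` is normal. -/
def IsNormaliser {X N A : C} (x : X ⟶ A) (n : X ⟶ N) (m : N ⟶ A) : Prop :=
  IsNormal n ∧ Mono m ∧ n ≫ m = x ∧
    ∀ ⦃N' : C⦄ (n' : X ⟶ N') (m' : N' ⟶ A),
      IsNormal n' → Mono m' → n' ≫ m' = x → ∃ h : N' ⟶ N, n' ≫ h = n ∧ h ≫ m = m'

/-- The normaliser of `x` exists. -/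
def HasNormaliser {X A : C} (x : X ⟶ A) : Prop :=
  ∃ (N : C) (n : X ⟶ N) (m : N ⟶ A), IsNormaliser x n m

/-- Split extensions with kernel `X`. -/
structure SplitExt (X : C) where
  A : C
  B : C
  κ : X ⟶ A
  α : A ⟶ B
  β : B ⟶ A
  section_proj : β ≫ α = 𝟙 B
  isKernel : IsKernelOf κ α

/-- Morphisms of split extensions with kernel `X`: they are the identity on `X` and commute with
the projections and the sections. -/
@[ext]
structure SplitExt.Hom {X : C} (S T : SplitExt X) where
  f : S.A ⟶ T.A
  g : S.B ⟶ T.B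
  κ_f : S.κ ≫ f = T.κ
  α_g : S.α ≫ g = f ≫ T.α
  β_f : S.β ≫ f = g ≫ T.β

/-- The category of split extensions with kernel `X`. -/
instance (X : C) : Category (SplitExt X) where
  Hom S T := SplitExt.Hom S T
  id S := ⟨𝟙 _, 𝟙 _, by simp, by simp, by simp⟩
  comp F G := ⟨F.f ≫ G.f, F.g ≫ G.g,
    by rw [← Category.assoc, F.κ_f, G.κ_f],
    by rw [← Category.assoc, F.α_g, Category.assoc, G.α_g, Category.assoc],
    by rw [← Category.assoc, F.β_f, Category.assoc, G.β_f, Category.assoc]⟩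
  id_comp F := SplitExt.Hom.ext (Category.id_comp F.f) (Category.id_comp F.g)
  comp_id F := SplitExt.Hom.ext (Category.comp_id F.f) (Category.comp_id F.g)
  assoc F G H := SplitExt.Hom.ext (Category.assoc F.f G.f H.f) (Category.assoc F.g G.g H.g)

/-- Action accessibility: for every `X`, the category of split extensions with kernel `X` has enough
subterminal objects, i.e. every object admits a morphism to a subterminal one. -/
def ActionAccessible (C : Type v) [Category.{w} C] [HasZeroMorphisms C] : Prop :=
  ∀ (X : C) (S : SplitExt X), ∃ T : SplitExt X, IsSubterminal T ∧ Nonempty (S ⟶ T)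

end SemiAb

/-! ### Heyting semilattices -/

/-- Heyting semilattices `(H, 1, ∧, ⇒)`. -/
class HeytingSemilattice (H : Type u) where
  one : H
  meet : H → H → H
  imp : H → H → H
  one_meet : ∀ x, meet one x = x
  meet_self : ∀ x, meet x x = x
  meet_comm : ∀ x y, meet x y = meet y x
  meet_assoc : ∀ x y z, meet x (meet y z) = meet (meet x y) z
  imp_self : ∀ x, imp x x = one
  meet_imp : ∀ x y, meet x (imp x y) = meet x y
  meet_imp_right : ∀ x y, meet y (imp x y) = y
  imp_meet : ∀ x y z, imp x (meet y z) = meet (imp x y) (imp x z)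

open HeytingSemilattice

/-- The category of Heyting semilattices. -/
structure HSLat : Type (u + 1) where
  carrier : Type u
  [str : HeytingSemilattice carrier]

namespace HSLat

attribute [instance] HSLat.str

/-- Morphisms of Heyting semilattices preserve the constant and the two operations. -/
@[ext]
structure Hom (A B : HSLat.{u}) where
  toFun : A.carrier → B.carrier
  map_one : toFun one = one
  map_meet : ∀ x y, toFun (meet x y) = meet (toFun x) (toFun y)
  map_imp : ∀ x y, toFun (imp x y) = imp (toFun x) (toFun y)

instance : Category HSLat.{u} where
  Hom A B := Hom A B
  id A := ⟨fun x => x, rfl, fun _ _ => rfl, fun _ _ => rfl⟩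
  comp f g := ⟨fun x => g.toFun (f.toFun x), by rw [f.map_one, g.map_one],
    fun x y => by rw [f.map_meet, g.map_meet], fun x y => by rw [f.map_imp, g.map_imp]⟩

/-- The zero morphisms of `HSLat` are the maps which are constantly `1`. -/
instance : HasZeroMorphisms HSLat.{u} where
  zero A B := ⟨⟨fun _ => one, rfl, fun _ _ => (one_meet _).symm, fun _ _ => (imp_self _).symm⟩⟩
  comp_zero _ _ := rfl
  zero_comp _ _ _ f := Hom.ext (funext fun _ => f.map_one)

/-- Subobjects of a Heyting semilattice: subsets closed under the operations. -/
structure Sub (A : HSLat.{u}) where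
  carrier : Set A.carrier
  one_mem : one ∈ carrier
  meet_mem : ∀ {x y}, x ∈ carrier → y ∈ carrier → meet x y ∈ carrier
  imp_mem : ∀ {x y}, x ∈ carrier → y ∈ carrier → imp x y ∈ carrier

/-- The Heyting semilattice underlying a subobject. -/
def Sub.toHSLat {A : HSLat.{u}} (S : Sub A) : HSLat.{u} where
  carrier := S.carrier
  str :=
    { one := ⟨one, S.one_mem⟩
      meet := fun x y => ⟨meet x.1 y.1, S.meet_mem x.2 y.2⟩
      imp := fun x y => ⟨imp x.1 y.1, S.imp_mem x.2 y.2⟩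
      one_meet := fun _ => Subtype.ext (one_meet _)
      meet_self := fun _ => Subtype.ext (meet_self _)
      meet_comm := fun _ _ => Subtype.ext (meet_comm _ _)
      meet_assoc := fun _ _ _ => Subtype.ext (meet_assoc _ _ _)
      imp_self := fun _ => Subtype.ext (imp_self _)
      meet_imp := fun _ _ => Subtype.ext (meet_imp _ _)
      meet_imp_right := fun _ _ => Subtype.ext (meet_imp_right _ _)
      imp_meet := fun _ _ _ => Subtype.ext (imp_meet _ _ _) }

/-- The inclusion of a subobject. -/
def Sub.incl {A : HSLat.{u}} (S : Sub A) : S.toHSLat ⟶ A :=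
  Hom.mk (fun x => x.1) rfl (fun _ _ => rfl) (fun _ _ => rfl)

end HSLat

/-- The four-element chain `0 < 1 < 2 < 3` as a Heyting semilattice with top element `3`. -/
instance chainFour : HeytingSemilattice (Fin 4) where
  one := 3
  meet a b := min a b
  imp a b := if a ≤ b then 3 else b
  one_meet := by decide
  meet_self := by decide
  meet_comm := by decide
  meet_assoc := by decide
  imp_self := by decide
  meet_imp := by decide
  meet_imp_right := by decide
  imp_meet := by decide

/-- Products of Heyting semilattices, with componentwise operations. -/
instance prodHeytingSemilattice (H : Type u) (K : Type v) [HeytingSemilattice H]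
    [HeytingSemilattice K] : HeytingSemilattice (H × K) where
  one := (one, one)
  meet x y := (meet x.1 y.1, meet x.2 y.2)
  imp x y := (imp x.1 y.1, imp x.2 y.2)
  one_meet _ := Prod.ext (one_meet _) (one_meet _)
  meet_self _ := Prod.ext (meet_self _) (meet_self _)
  meet_comm _ _ := Prod.ext (meet_comm _ _) (meet_comm _ _)
  meet_assoc _ _ _ := Prod.ext (meet_assoc _ _ _) (meet_assoc _ _ _)
  imp_self _ := Prod.ext (imp_self _) (imp_self _)
  meet_imp _ _ := Prod.ext (meet_imp _ _) (meet_imp _ _)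
  meet_imp_right _ _ := Prod.ext (meet_imp_right _ _) (meet_imp_right _ _)
  imp_meet _ _ _ := Prod.ext (imp_meet _ _ _) (imp_meet _ _ _)

/-- Transport of the structure to a larger universe. -/
instance uliftHeytingSemilattice (H : Type v) [HeytingSemilattice H] :
    HeytingSemilattice (ULift.{u} H) where
  one := ⟨one⟩
  meet x y := ⟨meet x.down y.down⟩
  imp x y := ⟨imp x.down y.down⟩
  one_meet _ := ULift.ext _ _ (one_meet _)
  meet_self _ := ULift.ext _ _ (meet_self _)
  meet_comm _ _ := ULift.ext _ _ (meet_comm _ _)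
  meet_assoc _ _ _ := ULift.ext _ _ (meet_assoc _ _ _)
  imp_self _ := ULift.ext _ _ (imp_self _)
  meet_imp _ _ := ULift.ext _ _ (meet_imp _ _)
  meet_imp_right _ _ := ULift.ext _ _ (meet_imp_right _ _)
  imp_meet _ _ _ := ULift.ext _ _ (imp_meet _ _ _)

/-- The Heyting semilattice `A = C₄ × C₄`, where `C₄` is the four-element chain. -/
def exampleA : HSLat.{u} where
  carrier := ULift.{u} (Fin 4 × Fin 4)

/-- The subobject `X = {(2, 2), (3, 3)}` of `A = C₄ × C₄`. -/
def exampleX : HSLat.Sub exampleA.{u} where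
  carrier := {p | p = ⟨(2, 2)⟩ ∨ p = ⟨(3, 3)⟩}
  one_mem := Or.inr rfl
  meet_mem := by
    rintro _ _ (rfl | rfl) (rfl | rfl)
    exacts [Or.inl rfl, Or.inl rfl, Or.inl rfl, Or.inr rfl]
  imp_mem := by
    rintro _ _ (rfl | rfl) (rfl | rfl)
    exacts [Or.inr rfl, Or.inr rfl, Or.inl rfl, Or.inr rfl]

/-! ### Kernels and the split short five lemma in pointed categories -/

namespace SemiAb

variable {C : Type v} [Category.{w} C] [HasZeroMorphisms C]

/-! For the implication, let `x` be a kernel of `f : A ⟶ B`. The kernel pair of `f` carries the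
conjugation extension of `A` by `X`. Map it to a subterminal split extension `T`; the kernel of the
base component `g : A ⟶ T.B` is the centraliser. It cooperates with `x` because the square over `g`
is a pullback, so that the action is trivial over the kernel. It is the largest such subobject
because a cooperating `y` makes `X × Y` a split extension with two morphisms to `T`, with base
components `y ≫ g` and `0`, which must agree (`isCentraliser_of_hom_subterminal`).

In `HSLat` normal subobjects are filters. The centraliser of a filter `X` is the filter of all `a`
with `a ⇒ x = x` for `x ∈ X`, which settles existence and normality directly
(`isCentraliser_centraliser`). Action accessibility fails on the chain `{0, 1, 2, 3}` over `{0, 1,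
3}` with kernel `{2, 3}`: the chain `{0, 2, 3}` maps to it with `0 ↦ 0` or `0 ↦ 1`, so a morphism to
a subterminal object identifies `0` with `1`, hence sends `0 = (1 ⇒ 0)` and everything above it to
the top, and the kernel collapses.

A normaliser of `X` would contain `(0, 1)` and `(1, 0)`, each of which can be added to `X` with `X`
still a filter. Together they generate `(2, 3)`, which is above `(2, 2)` but not in `X`.

That `HSLat` is semi-abelian rests on congruence quotients, term coproducts and, for
protomodularity, the identity `meet_imp_imp_imp`. -/

theorem IsKernelOf.mk {K A B : C} {k : K ⟶ A} {f : A ⟶ B} (h : k ≫ f = 0)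
    (hk : ∀ ⦃W : C⦄ (a b : W ⟶ K), a ≫ k = b ≫ k → a = b)
    (hl : ∀ ⦃W : C⦄ (g : W ⟶ A), g ≫ f = 0 → ∃ l, l ≫ k = g) : IsKernelOf k f :=
  ⟨h, ⟨isLimitAux _ (fun s => (hl s.ι s.condition).choose)
    (fun s => (hl s.ι s.condition).choose_spec)
    (fun s _ hm => hk _ _ (hm.trans (hl s.ι s.condition).choose_spec.symm))⟩⟩

theorem IsKernelOf.zero {K A B : C} {k : K ⟶ A} {f : A ⟶ B} (h : IsKernelOf k f) : k ≫ f = 0 :=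
  h.1

theorem IsKernelOf.exists_lift {K A B W : C} {k : K ⟶ A} {f : A ⟶ B} (h : IsKernelOf k f)
    (g : W ⟶ A) (hg : g ≫ f = 0) : ∃ l : W ⟶ K, l ≫ k = g := by
  obtain ⟨_, ⟨hl⟩⟩ := h
  exact ⟨_, (KernelFork.IsLimit.lift' hl g hg).2⟩

theorem IsKernelOf.hom_ext {K A B W : C} {k : K ⟶ A} {f : A ⟶ B} (h : IsKernelOf k f)
    {a b : W ⟶ K} (hab : a ≫ k = b ≫ k) : a = b := by
  obtain ⟨_, ⟨hl⟩⟩ := h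
  exact Fork.IsLimit.hom_ext hl hab

theorem isKernelOf_kernel_ι {A B : C} (f : A ⟶ B) [HasKernel f] : IsKernelOf (kernel.ι f) f :=
  ⟨kernel.condition f, ⟨kernelIsKernel f⟩⟩

/-- Kernels are changes of base along `0 ⟶ B`, the form in which protomodularity applies to them. -/
theorem IsKernelOf.isPullback {K A B Z : C} {k : K ⟶ A} {f : A ⟶ B} (h : IsKernelOf k f)
    (hZ : IsZero Z) : IsPullback k (0 : K ⟶ Z) f (0 : Z ⟶ B) := by
  refine ⟨⟨by simp [h.zero]⟩, ⟨PullbackCone.isLimitAux' _ fun s => ?_⟩⟩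
  have hs : s.fst ≫ f = 0 := by rw [s.condition, hZ.eq_zero_of_tgt s.snd, zero_comp]
  exact ⟨(h.exists_lift s.fst hs).choose, (h.exists_lift s.fst hs).choose_spec,
    hZ.eq_of_tgt _ _, fun hm _ => h.hom_ext (hm.trans (h.exists_lift s.fst hs).choose_spec.symm)⟩

/-- The split short five lemma. -/
theorem Protomodular.isIso_of_isKernelOf (hC : Protomodular C) [HasZeroObject C]
    {A A' B K : C} {α : A ⟶ B} {β : B ⟶ A} {α' : A' ⟶ B} {β' : B ⟶ A'} {f : A ⟶ A'}
    {κ : K ⟶ A} {κ' : K ⟶ A'} (hβ : β ≫ α = 𝟙 B) (hβ' : β' ≫ α' = 𝟙 B) (hα : f ≫ α' = α)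
    (hf : β ≫ f = β') (hκ : IsKernelOf κ α) (hκ' : IsKernelOf κ' α') (h : κ ≫ f = κ') :
    IsIso f := by
  obtain ⟨Z, hZ⟩ := HasZeroObject.zero (C := C)
  exact hC _ α β α' β' f κ 0 κ' 0 (𝟙 K) hβ hβ' hα hf (hκ.isPullback hZ) (hκ'.isPullback hZ)
    (by simp [h]) (by simp) inferInstance

/-- The canonical injections into a product are jointly epimorphic. -/
theorem Protomodular.prod_hom_ext (hC : Protomodular C) [HasZeroObject C] [HasEqualizers C]
    {P X Y W : C} {p : P ⟶ X} {q : P ⟶ Y} (hP : IsLimit (BinaryFan.mk p q)) {i : X ⟶ P}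
    {j : Y ⟶ P} (hip : i ≫ p = 𝟙 X) (hjp : j ≫ p = 0) (hjq : j ≫ q = 𝟙 Y)
    {f g : P ⟶ W} (hi : i ≫ f = i ≫ g) (hj : j ≫ f = j ≫ g) : f = g := by
  have ext : ∀ ⦃V : C⦄ (a b : V ⟶ P), a ≫ p = b ≫ p → a ≫ q = b ≫ q → a = b :=
    fun V a b h₁ h₂ => BinaryFan.IsLimit.hom_ext hP h₁ h₂
  have hjk : IsKernelOf j p := by
    refine .mk hjp (fun V a b h => ?_) (fun V g hg => ⟨g ≫ q, ext _ _ ?_ ?_⟩)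
    · simpa [hjq] using h =≫ q
    · simp [hjp, hg]
    · simp [hjq]
  have hjk' : IsKernelOf (equalizer.lift j hj) (equalizer.ι f g ≫ p) := by
    refine .mk (by simp [hjp]) (fun V a b h => ?_) (fun V k hk => ?_)
    · exact hjk.hom_ext (by simpa using h =≫ equalizer.ι f g)
    · obtain ⟨l, hl⟩ := hjk.exists_lift (k ≫ equalizer.ι f g) (by simpa using hk)
      exact ⟨l, by rw [← cancel_mono (equalizer.ι f g)]; simpa using hl⟩
  -- The equaliser contains both injections, so over `X` it is a point with the same section and the
  -- same kernel as the product.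
  have : IsIso (equalizer.ι f g) :=
    hC.isIso_of_isKernelOf (β := equalizer.lift i hi) (by simp [hip]) hip rfl (by simp) hjk' hjk
      (by simp)
  rw [← cancel_epi (equalizer.ι f g)]
  exact equalizer.condition f g

/-- Morphisms of split extensions with a fixed kernel are pullback squares. -/
theorem Protomodular.isPullback_splitExt (hC : Protomodular C) [HasZeroObject C] [HasPullbacks C]
    {X : C} {S T : SplitExt X} (F : SplitExt.Hom S T) : IsPullback F.f S.α T.α F.g := by
  have hP := IsPullback.of_hasPullback T.α F.g
  have hκ : IsKernelOf (hP.lift T.κ 0 (by simp [T.isKernel.zero])) (pullback.snd T.α F.g) := by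
    refine .mk (by simp) (fun V a b h => T.isKernel.hom_ext ?_) (fun V k hk => ?_)
    · simpa using h =≫ pullback.fst _ _
    · obtain ⟨l, hl⟩ := T.isKernel.exists_lift (k ≫ pullback.fst _ _)
        (by simp [pullback.condition, reassoc_of% hk])
      exact ⟨l, hP.hom_ext (by simpa using hl) (by simp [hk])⟩
  -- The comparison with the actual pullback is a morphism of points over `S.B` that is the identity
  -- on the kernel `X`.
  have : IsIso (hP.lift F.f S.α F.α_g.symm) := hC.isIso_of_isKernelOf (β := S.β)
    (β' := hP.lift (F.g ≫ T.β) (𝟙 _) (by simp [T.section_proj])) S.section_proj (by simp)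
    (by simp) (hP.hom_ext (by simp [F.β_f]) (by simp [S.section_proj]))
    S.isKernel hκ (hP.hom_ext (by simp [F.κ_f]) (by simp [S.isKernel.zero]))
  exact hP.of_iso (asIso (hP.lift F.f S.α F.α_g.symm)).symm (Iso.refl _) (Iso.refl _)
    (Iso.refl _) (by simp) (by simp) (by simp) (by simp)

/-! ### Centralisers from action accessibility -/

/-- Any two centralisers of a morphism are isomorphic, so that one is normal if the other is. -/
theorem IsCentraliser.isNormal_of_isNormal {X A Z Z' : C} {x : X ⟶ A} {z : Z ⟶ A} {z' : Z' ⟶ A}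
    (h : IsCentraliser x z) (h' : IsCentraliser x z') (hz : IsNormal z) : IsNormal z' := by
  obtain ⟨B, f, hf⟩ := hz
  obtain ⟨a, ha⟩ := h.2.2 z' h'.1 h'.2.1
  obtain ⟨b, hb⟩ := h'.2.2 z h.1 h.2.1
  have := h'.1
  refine ⟨B, f, .mk (by rw [← ha, Category.assoc, hf.zero, comp_zero])
    (fun V c d => (cancel_mono z').1) (fun V k hk => ?_)⟩
  obtain ⟨l, hl⟩ := hf.exists_lift k hk
  exact ⟨l ≫ b, by rw [Category.assoc, hb, hl]⟩

/-- The split extension of `A` by a normal subobject `X` given by the kernel pair of a morphism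
with kernel `X`, in which `A` acts on `X` by conjugation. -/
noncomputable def conjugation {X A B R : C} {x : X ⟶ A} {f : A ⟶ B} (hx : IsKernelOf x f)
    {r s : R ⟶ A} (hR : IsKernelPair f r s) : SplitExt X where
  A := R
  B := A
  κ := hR.lift 0 x (by simp [hx.zero])
  α := r
  β := hR.lift (𝟙 _) (𝟙 _) rfl
  section_proj := hR.lift_fst _ _ _
  isKernel := by
    refine .mk (hR.lift_fst _ _ _) (fun V a b h => hx.hom_ext ?_) (fun V k hk => ?_)
    · simpa using h =≫ s
    · obtain ⟨l, hl⟩ := hx.exists_lift (k ≫ s) (by simp [← hR.w, reassoc_of% hk])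
      exact ⟨l, hR.hom_ext (by simp [hk]) (by simpa using hl)⟩

/-- The split extension `X × Y ⟶ Y` with kernel `X`. -/
def trivialSplitExt {X Y P : C} {p : P ⟶ X} {q : P ⟶ Y} (hP : IsLimit (BinaryFan.mk p q))
    (i : X ⟶ P) (j : Y ⟶ P) (hip : i ≫ p = 𝟙 X) (hiq : i ≫ q = 0) (hjq : j ≫ q = 𝟙 Y) :
    SplitExt X where
  A := P
  B := Y
  κ := i
  α := q
  β := j
  section_proj := hjq
  isKernel := by
    refine .mk hiq (fun V a b h => ?_) (fun V k hk => ⟨k ≫ p, ?_⟩)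
    · simpa [hip] using h =≫ p
    · exact BinaryFan.IsLimit.hom_ext hP (by simp [hip]) (by simp [hiq, hk])

/-- The kernel of a morphism from the conjugation extension to a subterminal split extension is a
centraliser. -/
theorem isCentraliser_of_hom_subterminal (hC : Protomodular C) [HasZeroObject C]
    [HasFiniteLimits C] {X A B R : C} {x : X ⟶ A} {f : A ⟶ B} (hx : IsKernelOf x f)
    {r s : R ⟶ A} (hR : IsKernelPair f r s) {T : SplitExt X} (hT : IsSubterminal T)
    (F : SplitExt.Hom (conjugation hx hR) T) {Z : C} {z : Z ⟶ A}
    (hz : IsKernelOf z (show A ⟶ T.B from F.g)) : IsCentraliser x z := by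
  obtain ⟨c, g, hκ, hα, hβ⟩ := F
  change R ⟶ T.A at c
  change A ⟶ T.B at g
  change IsKernelOf z g at hz
  have hpb : IsPullback c r T.α g :=
    hC.isPullback_splitExt (S := conjugation hx hR) ⟨c, g, hκ, hα, hβ⟩
  replace hκ : hR.lift 0 x (by simp [hx.zero]) ≫ c = T.κ := hκ
  replace hβ : hR.lift (𝟙 _) (𝟙 _) rfl ≫ c = g ≫ T.β := hβ
  refine ⟨⟨fun a b h => hz.hom_ext h⟩, ?_, ?_⟩
  · let i : X ⟶ X ⨯ Z := prod.lift (𝟙 X) 0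
    let j : Z ⟶ X ⨯ Z := prod.lift 0 (𝟙 Z)
    have hip : i ≫ prod.fst = 𝟙 X := prod.lift_fst _ _
    have hiq : i ≫ prod.snd = 0 := prod.lift_snd _ _
    have hjp : j ≫ prod.fst = 0 := prod.lift_fst _ _
    have hjq : j ≫ prod.snd = 𝟙 Z := prod.lift_snd _ _
    -- Since `z ≫ g = 0`, both components vanish in `T.B`. The cooperator is then `d ≫ s`, the
    -- second leg of the kernel pair.
    let d : X ⨯ Z ⟶ R := hpb.lift (prod.fst ≫ T.κ) (prod.snd ≫ z)
      (by simp [T.isKernel.zero, hz.zero])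
    have hd₁ : d ≫ c = prod.fst ≫ T.κ := hpb.lift_fst _ _ _
    have hd₂ : d ≫ r = prod.snd ≫ z := hpb.lift_snd _ _ _
    have hi : i ≫ d = hR.lift 0 x (by simp [hx.zero]) :=
      hpb.hom_ext (by simp [hd₁, hκ, reassoc_of% hip]) (by simp [hd₂, reassoc_of% hiq])
    have hj : j ≫ d = z ≫ hR.lift (𝟙 _) (𝟙 _) rfl :=
      hpb.hom_ext (by simp [hd₁, hβ, reassoc_of% hz.zero, reassoc_of% hjp])
        (by simp [hd₂, reassoc_of% hjq])
    exact ⟨X ⨯ Z, prod.fst, prod.snd, i, j, d ≫ s, ⟨prodIsProd X Z⟩, hip, hiq, hjp, hjq,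
      by simp [reassoc_of% hi], by simp [reassoc_of% hj]⟩
  · rintro Y y - ⟨P, p, q, i, j, φ, ⟨hP⟩, hip, hiq, hjp, hjq, hiφ, hjφ⟩
    -- Hence `(q ≫ y, φ)` lands in the kernel pair, and is a morphism from the trivial extension `X
    -- × Y` to the conjugation extension.
    have hφ : (q ≫ y) ≫ f = φ ≫ f := hC.prod_hom_ext hP hip hjp hjq
      (by simp [reassoc_of% hiq, reassoc_of% hiφ, hx.zero])
      (by simp [reassoc_of% hjq, reassoc_of% hjφ])
    have hi : i ≫ hR.lift (q ≫ y) φ hφ = hR.lift 0 x (by simp [hx.zero]) :=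
      hR.hom_ext (by simp [reassoc_of% hiq]) (by simp [hiφ])
    have hj : j ≫ hR.lift (q ≫ y) φ hφ = y ≫ hR.lift (𝟙 _) (𝟙 _) rfl :=
      hR.hom_ext (by simp [reassoc_of% hjq]) (by simp [hjφ])
    have h₁ : i ≫ hR.lift (q ≫ y) φ hφ ≫ c = T.κ := by rw [reassoc_of% hi, hκ]
    have h₂ : q ≫ y ≫ g = (hR.lift (q ≫ y) φ hφ ≫ c) ≫ T.α := by simp [hpb.w]
    have h₃ : j ≫ hR.lift (q ≫ y) φ hφ ≫ c = (y ≫ g) ≫ T.β := by simp [reassoc_of% hj, hβ]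
    have h₁' : i ≫ p ≫ T.κ = T.κ := by simp [reassoc_of% hip]
    have h₂' : q ≫ (0 : Y ⟶ T.B) = (p ≫ T.κ) ≫ T.α := by simp [T.isKernel.zero]
    have h₃' : j ≫ p ≫ T.κ = (0 : Y ⟶ T.B) ≫ T.β := by simp [reassoc_of% hjp]
    let E := trivialSplitExt hP i j hip hiq hjq
    -- `G` passes through the conjugation extension, `G'` through the projection to `X`. Their base
    -- components are `y ≫ g` and `0`.
    let G : E ⟶ T := SplitExt.Hom.mk (S := E) _ _ h₁ h₂ h₃
    let G' : E ⟶ T := SplitExt.Hom.mk (S := E) _ _ h₁' h₂' h₃'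
    exact hz.exists_lift y (congrArg SplitExt.Hom.g (hT G G'))

theorem hasNormalCentralisers_of_actionAccessible (hC : IsSemiAbelian C)
    (h : ActionAccessible C) : HasNormalCentralisers C := by
  have := hC.hasZeroObject
  have := hC.regular
  rintro X A x ⟨B, f, hx⟩
  obtain ⟨T, hT, ⟨F⟩⟩ := h X (conjugation hx (IsPullback.of_hasPullback f f))
  have hz := isKernelOf_kernel_ι (show A ⟶ T.B from F.g)
  have hc := isCentraliser_of_hom_subterminal hC.protomodular hx _ hT F hz
  exact ⟨⟨_, _, hc⟩, fun Z z hz' => hc.isNormal_of_isNormal hz' ⟨_, _, hz⟩⟩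

end SemiAb

/-! ### Arithmetic of Heyting semilattices -/

namespace HeytingSemilattice

variable {H : Type u} [HeytingSemilattice H] {x y z : H}

theorem meet_one (x : H) : meet x one = x := by rw [meet_comm, one_meet]

theorem one_imp (x : H) : imp one x = x := by rw [← one_meet (imp one x), meet_imp, one_meet]

theorem imp_one (x : H) : imp x one = one := by rw [← one_meet (imp x one), meet_imp_right]

/-- The order of a Heyting semilattice. -/
def Le (x y : H) : Prop := meet x y = x

theorem Le.refl (x : H) : Le x x := meet_self x

theorem Le.trans (h : Le x y) (h' : Le y z) : Le x z := by
  unfold Le at *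
  rw [← h, ← meet_assoc, h']

theorem Le.antisymm (h : Le x y) (h' : Le y x) : x = y := by
  unfold Le at *
  rw [← h, meet_comm, h']

theorem meet_le_left (x y : H) : Le (meet x y) x := by
  unfold Le
  rw [meet_comm, meet_assoc, meet_self]

theorem meet_le_right (x y : H) : Le (meet x y) y := by
  unfold Le
  rw [← meet_assoc, meet_self]

theorem le_meet (h : Le x y) (h' : Le x z) : Le x (meet y z) := by
  unfold Le at *
  rw [meet_assoc, h, h']

/-- From right to left, apply `x ⇒ -` to `z ∧ x ≤ y`: as `⇒` distributes over meets, `x ⇒ z ≤ x ⇒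
y`, and `z ≤ x ⇒ z`. -/
theorem le_imp_iff : Le z (imp x y) ↔ Le (meet z x) y := by
  constructor
  · intro h
    have : meet (meet z (imp x y)) x = meet (meet z x) y := by
      rw [← meet_assoc, meet_comm _ x, meet_imp, meet_assoc]
    unfold Le at *
    rw [← this, h]
  · intro h
    have h₁ : meet (imp x z) (imp x y) = imp x z := by
      have := congrArg (imp x) h
      rwa [imp_meet, imp_meet, imp_self, meet_one] at this
    unfold Le
    have h₂ := congrArg (meet z) h₁
    rwa [meet_assoc, meet_imp_right] at h₂

theorem le_imp (x y : H) : Le y (imp x y) := meet_imp_right x y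

theorem imp_eq_one_iff : imp x y = one ↔ Le x y := by
  constructor
  · intro h
    rw [Le, ← meet_imp, h, meet_one]
  · intro h
    have := le_imp_iff.2 (show Le (meet one x) y by rwa [one_meet])
    rwa [Le, one_meet] at this

theorem meet_imp_le (x y : H) : Le (meet x (imp x y)) y := by
  rw [meet_imp]
  exact meet_le_right x y

theorem eq_of_imp_eq_one (h : imp x y = one) (h' : imp y x = one) : x = y :=
  (imp_eq_one_iff.1 h).antisymm (imp_eq_one_iff.1 h')

theorem meet_imp_imp (x y z : H) : imp (meet x y) z = imp x (imp y z) := by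
  have h (w : H) : Le w (imp (meet x y) z) ↔ Le w (imp x (imp y z)) := by
    rw [le_imp_iff, le_imp_iff, le_imp_iff, meet_assoc]
  exact ((h _).1 (.refl _)).antisymm ((h _).2 (.refl _))

theorem imp_le_imp_left (z : H) (h : Le x y) : Le (imp y z) (imp x z) :=
  le_imp_iff.2 (Le.trans (le_meet ((meet_le_right _ _).trans h) (meet_le_left _ _))
    (meet_imp_le y z))

theorem le_imp_imp (x y : H) : Le x (imp (imp x y) y) := le_imp_iff.2 (meet_imp_le x y)

/-- This recovers `x` from `y` and the two elements `x ⇒ y` and `((x ⇒ y) ⇒ y) ⇒ x`, both equal to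
`1` as soon as `x` and `y` are identified. Protomodularity comes from it. -/
theorem meet_imp_imp_imp (x y : H) :
    meet (imp (imp x y) y) (imp (imp (imp x y) y) x) = x := by
  rw [meet_imp, meet_comm]
  exact le_imp_imp x y

/-- Below `d`, an implication depends only on the parts of its arguments below `d`; hence filter
congruences respect `⇒`. -/
theorem meet_meet_imp_meet (d x y : H) : meet d (imp (meet d x) (meet d y)) = meet d (imp x y) := by
  refine Le.antisymm (le_meet (meet_le_left _ _) (le_imp_iff.2 ?_))
    (le_meet (meet_le_left _ _) (le_imp_iff.2 (le_meet ?_ ?_)))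
  · refine Le.trans (le_meet (le_meet ((meet_le_left _ _).trans (meet_le_left _ _))
      (meet_le_right _ _)) ((meet_le_left _ _).trans (meet_le_right _ _))) ?_
    exact (meet_imp_le _ _).trans (meet_le_right _ _)
  · exact (meet_le_left _ _).trans (meet_le_left _ _)
  · exact Le.trans (le_meet ((meet_le_right _ _).trans (meet_le_right _ _))
      ((meet_le_left _ _).trans (meet_le_right _ _))) (meet_imp_le _ _)

theorem meet_meet_meet_comm (a b c d : H) :
    meet (meet a b) (meet c d) = meet (meet a c) (meet b d) := by
  rw [← meet_assoc, ← meet_assoc, meet_assoc b, meet_comm b c, ← meet_assoc c]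

end HeytingSemilattice

/-! ### Morphisms of Heyting semilattices -/

namespace HSLat

variable {A B D : HSLat.{u}}

theorem hom_ext {f g : A ⟶ B} (h : ∀ a, f.toFun a = g.toFun a) : f = g :=
  Hom.ext (funext h)

theorem comp_toFun (f : A ⟶ B) (g : B ⟶ D) (a : A.carrier) :
    (f ≫ g).toFun a = g.toFun (f.toFun a) := rfl

theorem zero_toFun (a : A.carrier) : (0 : A ⟶ B).toFun a = one := rfl

theorem toFun_eq_of_comp_eq {f : A ⟶ B} {g : B ⟶ D} {h : A ⟶ D} (w : f ≫ g = h)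
    (a : A.carrier) : g.toFun (f.toFun a) = h.toFun a := by
  rw [← w, comp_toFun]

/-- The inverse of a bijective morphism. -/
noncomputable def invOfBijective (f : A ⟶ B) (hf : Function.Bijective f.toFun) : B ⟶ A :=
  let e := Equiv.ofBijective f.toFun hf
  have he : ∀ b, f.toFun (e.symm b) = b := e.apply_symm_apply
  Hom.mk e.symm (hf.1 (by rw [he, f.map_one]))
    (fun x y => hf.1 (by rw [f.map_meet, he, he, he]))
    (fun x y => hf.1 (by rw [f.map_imp, he, he, he]))

theorem isIso_of_bijective (f : A ⟶ B) (hf : Function.Bijective f.toFun) : IsIso f :=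
  ⟨invOfBijective f hf, hom_ext fun a => (Equiv.ofBijective f.toFun hf).symm_apply_apply a,
    hom_ext fun b => (Equiv.ofBijective f.toFun hf).apply_symm_apply b⟩

theorem bijective_of_isIso (f : A ⟶ B) [IsIso f] : Function.Bijective f.toFun :=
  Function.bijective_iff_has_inverse.2 ⟨(inv f).toFun,
    toFun_eq_of_comp_eq (IsIso.hom_inv_id f), toFun_eq_of_comp_eq (IsIso.inv_hom_id f)⟩

/-- Equality is detected by the top element: `a = b` as soon as `a ⇒ b` and `b ⇒ a` are both `1`. -/
theorem injective_of_imp_eq_one (f : A ⟶ B) (h : ∀ a, f.toFun a = one → a = one) :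
    Function.Injective f.toFun := fun a b hab =>
  eq_of_imp_eq_one (h _ (by rw [f.map_imp, hab, HeytingSemilattice.imp_self]))
    (h _ (by rw [f.map_imp, hab, HeytingSemilattice.imp_self]))

/-- A morphism whose values lie in a subobject factors through it. -/
def Sub.lift (S : Sub B) (f : A ⟶ B) (h : ∀ a, f.toFun a ∈ S.carrier) : A ⟶ S.toHSLat :=
  Hom.mk (fun a => ⟨f.toFun a, h a⟩) (Subtype.ext f.map_one)
    (fun x y => Subtype.ext (f.map_meet x y)) (fun x y => Subtype.ext (f.map_imp x y))

/-- The factorisation of a morphism through a surjective one. -/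
noncomputable def descOfSurjective (q : A ⟶ B) (hq : Function.Surjective q.toFun) (f : A ⟶ D)
    (h : ∀ a b, q.toFun a = q.toFun b → f.toFun a = f.toFun b) : B ⟶ D :=
  have key (a : A.carrier) : f.toFun (Function.surjInv hq (q.toFun a)) = f.toFun a :=
    h _ _ (Function.surjInv_eq hq _)
  Hom.mk (fun b => f.toFun (Function.surjInv hq b))
    (by rw [← q.map_one, key, f.map_one])
    (fun x y => by
      obtain ⟨a, rfl⟩ := hq x
      obtain ⟨b, rfl⟩ := hq y
      rw [← q.map_meet, key, key, key, f.map_meet])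
    (fun x y => by
      obtain ⟨a, rfl⟩ := hq x
      obtain ⟨b, rfl⟩ := hq y
      rw [← q.map_imp, key, key, key, f.map_imp])

theorem comp_descOfSurjective (q : A ⟶ B) (hq : Function.Surjective q.toFun) (f : A ⟶ D)
    (h : ∀ a b, q.toFun a = q.toFun b → f.toFun a = f.toFun b) :
    q ≫ descOfSurjective q hq f h = f :=
  hom_ext fun _ => h _ _ (Function.surjInv_eq hq _)

theorem epi_of_surjective (q : A ⟶ B) (hq : Function.Surjective q.toFun) : Epi q where
  left_cancellation f g h := hom_ext fun b => by
    obtain ⟨a, rfl⟩ := hq b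
    exact toFun_eq_of_comp_eq h a

/-! ### Limits -/

/-- The product of two Heyting semilattices. -/
def prodObj (A B : HSLat.{u}) : HSLat.{u} := ⟨A.carrier × B.carrier⟩

/-- The fibre product of two morphisms. -/
def fibreProd (f : A ⟶ D) (g : B ⟶ D) : Sub (prodObj A B) where
  carrier := {p | f.toFun p.1 = g.toFun p.2}
  one_mem := f.map_one.trans g.map_one.symm
  meet_mem {p q} hp hq := (f.map_meet p.1 q.1).trans
    ((congrArg₂ meet hp hq).trans (g.map_meet p.2 q.2).symm)
  imp_mem {p q} hp hq := (f.map_imp p.1 q.1).trans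
    ((congrArg₂ imp hp hq).trans (g.map_imp p.2 q.2).symm)

/-- The first projection of a fibre product. -/
def fibreProdFst (f : A ⟶ D) (g : B ⟶ D) : (fibreProd f g).toHSLat ⟶ A :=
  Hom.mk (fun p => p.1.1) rfl (fun _ _ => rfl) (fun _ _ => rfl)

/-- The second projection of a fibre product. -/
def fibreProdSnd (f : A ⟶ D) (g : B ⟶ D) : (fibreProd f g).toHSLat ⟶ B :=
  Hom.mk (fun p => p.1.2) rfl (fun _ _ => rfl) (fun _ _ => rfl)

/-- The morphism into a fibre product induced by a commutative square. -/
def fibreProdLift {E : HSLat.{u}} {f : A ⟶ D} {g : B ⟶ D} (a : E ⟶ A) (b : E ⟶ B)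
    (h : a ≫ f = b ≫ g) : E ⟶ (fibreProd f g).toHSLat :=
  Hom.mk (fun e => ⟨(a.toFun e, b.toFun e), toFun_eq_of_comp_eq h e⟩)
    (Subtype.ext (Prod.ext a.map_one b.map_one))
    (fun x y => Subtype.ext (Prod.ext (a.map_meet x y) (b.map_meet x y)))
    (fun x y => Subtype.ext (Prod.ext (a.map_imp x y) (b.map_imp x y)))

/-- Pointwise preimages are unique, so choosing them automatically preserves the operations. -/
theorem exists_lift_of_jointly_injective {E P : HSLat.{u}} {p : P ⟶ A} {q : P ⟶ B}
    (ext : ∀ x y, p.toFun x = p.toFun y → q.toFun x = q.toFun y → x = y) (a : E ⟶ A) (b : E ⟶ B)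
    (h : ∀ e, ∃ x, p.toFun x = a.toFun e ∧ q.toFun x = b.toFun e) :
    ∃ l : E ⟶ P, l ≫ p = a ∧ l ≫ q = b := by
  choose l hl₁ hl₂ using h
  refine ⟨Hom.mk l (ext _ _ ?_ ?_) (fun x y => ext _ _ ?_ ?_) (fun x y => ext _ _ ?_ ?_),
    hom_ext hl₁, hom_ext hl₂⟩
  · rw [hl₁, a.map_one, p.map_one]
  · rw [hl₂, b.map_one, q.map_one]
  · rw [p.map_meet, hl₁, hl₁, hl₁, a.map_meet]
  · rw [q.map_meet, hl₂, hl₂, hl₂, b.map_meet]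
  · rw [p.map_imp, hl₁, hl₁, hl₁, a.map_imp]
  · rw [q.map_imp, hl₂, hl₂, hl₂, b.map_imp]

theorem isPullback_of_existsUnique {P : HSLat.{u}} {p : P ⟶ A} {q : P ⟶ B} {f : A ⟶ D}
    {g : B ⟶ D} (w : p ≫ f = q ≫ g)
    (h : ∀ a b, f.toFun a = g.toFun b → ∃! x, p.toFun x = a ∧ q.toFun x = b) :
    IsPullback p q f g := by
  have ext (x y : P.carrier) (h₁ : p.toFun x = p.toFun y) (h₂ : q.toFun x = q.toFun y) : x = y :=
    (h _ _ (toFun_eq_of_comp_eq w y)).unique ⟨h₁, h₂⟩ ⟨rfl, rfl⟩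
  refine ⟨⟨w⟩, ⟨PullbackCone.isLimitAux' _ fun s => ?_⟩⟩
  have hs := exists_lift_of_jointly_injective ext s.fst s.snd
    fun e => (h _ _ (toFun_eq_of_comp_eq s.condition e)).exists
  refine ⟨hs.choose, hs.choose_spec.1, hs.choose_spec.2, fun {m} hm₁ hm₂ => hom_ext fun e =>
    ext _ _ ?_ ?_⟩
  · exact toFun_eq_of_comp_eq (hm₁.trans hs.choose_spec.1.symm) e
  · exact toFun_eq_of_comp_eq (hm₂.trans hs.choose_spec.2.symm) e

theorem isPullback_fibreProd (f : A ⟶ D) (g : B ⟶ D) :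
    IsPullback (fibreProdFst f g) (fibreProdSnd f g) f g :=
  isPullback_of_existsUnique (hom_ext fun x => x.2) fun a b h =>
    ⟨⟨(a, b), h⟩, ⟨rfl, rfl⟩, fun _ hy => Subtype.ext (Prod.ext hy.1 hy.2)⟩

/-- Comparison with the concrete fibre product; it allows arguing with elements in an arbitrary
pullback square. -/
theorem existsUnique_of_isPullback {P : HSLat.{u}} {p : P ⟶ A} {q : P ⟶ B} {f : A ⟶ D}
    {g : B ⟶ D} (h : IsPullback p q f g) {a : A.carrier} {b : B.carrier}
    (hab : f.toFun a = g.toFun b) : ∃! x, p.toFun x = a ∧ q.toFun x = b := by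
  let l := h.lift (fibreProdFst f g) (fibreProdSnd f g) (isPullback_fibreProd f g).w
  have hl₁ : l ≫ p = fibreProdFst f g := h.lift_fst _ _ _
  have hl₂ : l ≫ q = fibreProdSnd f g := h.lift_snd _ _ _
  have hml : fibreProdLift p q h.w ≫ l = 𝟙 P :=
    h.hom_ext (by rw [Category.assoc, hl₁]; rfl) (by rw [Category.assoc, hl₂]; rfl)
  refine ⟨l.toFun ⟨(a, b), hab⟩, ⟨toFun_eq_of_comp_eq hl₁ _, toFun_eq_of_comp_eq hl₂ _⟩, ?_⟩
  rintro x ⟨rfl, rfl⟩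
  exact (toFun_eq_of_comp_eq hml x).symm

instance : HasPullbacks HSLat.{u} :=
  have {X Y Z : HSLat.{u}} {f : X ⟶ Z} {g : Y ⟶ Z} : HasLimit (cospan f g) :=
    (isPullback_fibreProd f g).hasPullback
  hasPullbacks_of_hasLimit_cospan HSLat.{u}

instance : HasZeroObject HSLat.{u} := by
  let Z : HSLat.{u} := HSLat.mk PUnit
    (str := ⟨⟨⟩, fun _ _ => ⟨⟩, fun _ _ => ⟨⟩, fun _ => rfl, fun _ => rfl, fun _ _ => rfl,
      fun _ _ _ => rfl, fun _ => rfl, fun _ _ => rfl, fun _ _ => rfl, fun _ _ _ => rfl⟩)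
  refine ⟨Z, (IsZero.iff_id_eq_zero Z).2 (hom_ext fun _ => rfl)⟩

/-! ### Kernels -/

/-- The elements that a morphism maps to `1`. -/
def ker (f : A ⟶ B) : Sub A where
  carrier := {a | f.toFun a = one}
  one_mem := f.map_one
  meet_mem {x y} hx hy := (f.map_meet x y).trans ((congrArg₂ meet hx hy).trans (one_meet _))
  imp_mem {x y} hx hy := (f.map_imp x y).trans ((congrArg₂ imp hx hy).trans (one_imp _))

theorem isKernelOf_of_injective {K : HSLat.{u}} {k : K ⟶ A} {f : A ⟶ B}
    (hk : Function.Injective k.toFun) (h : ∀ a, f.toFun a = one ↔ ∃ x, k.toFun x = a) :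
    SemiAb.IsKernelOf k f := by
  refine .mk (hom_ext fun x => (h _).2 ⟨x, rfl⟩)
    (fun W a b hab => hom_ext fun x => hk (toFun_eq_of_comp_eq hab x)) (fun W g hg => ?_)
  obtain ⟨l, hl, -⟩ := exists_lift_of_jointly_injective (p := k) (q := k)
    (fun x y hxy _ => hk hxy) g g fun e =>
      ((h _).1 (toFun_eq_of_comp_eq hg e)).imp fun _ hx => ⟨hx, hx⟩
  exact ⟨l, hl⟩

/-- The inclusion of the elements sent to `1` and the zero morphism agree after `k`, hence are
equal. -/
theorem injective_of_isKernelOf {K : HSLat.{u}} {k : K ⟶ A} {f : A ⟶ B}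
    (h : SemiAb.IsKernelOf k f) : Function.Injective k.toFun :=
  injective_of_imp_eq_one k fun a ha => congrArg (fun l => l.toFun ⟨a, ha⟩)
    (h.hom_ext (a := (ker k).incl) (b := 0) (hom_ext fun x => x.2.trans k.map_one.symm))

theorem exists_of_isKernelOf {K : HSLat.{u}} {k : K ⟶ A} {f : A ⟶ B}
    (h : SemiAb.IsKernelOf k f) {a : A.carrier} (ha : f.toFun a = one) : ∃ x, k.toFun x = a := by
  obtain ⟨l, hl⟩ := h.exists_lift (ker f).incl (hom_ext fun x => x.2)
  exact ⟨l.toFun ⟨a, ha⟩, toFun_eq_of_comp_eq hl _⟩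

/-! ### Quotients -/

/-- Congruences on a Heyting semilattice. -/
structure Congruence (A : HSLat.{u}) extends Setoid A.carrier where
  meet' : ∀ {a b c d : A.carrier}, r a b → r c d → r (meet a c) (meet b d)
  imp' : ∀ {a b c d : A.carrier}, r a b → r c d → r (imp a c) (imp b d)

/-- The quotient by a congruence. -/
def Congruence.quotient (R : Congruence A) : HSLat.{u} where
  carrier := Quotient R.toSetoid
  str :=
    { one := Quotient.mk _ one
      meet := Quotient.map₂ meet fun _ _ h _ _ h' => R.meet' h h'
      imp := Quotient.map₂ imp fun _ _ h _ _ h' => R.imp' h h'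
      one_meet := by rintro ⟨x⟩; exact congrArg (Quotient.mk _) (one_meet _)
      meet_self := by rintro ⟨x⟩; exact congrArg (Quotient.mk _) (meet_self _)
      meet_comm := by rintro ⟨x⟩ ⟨y⟩; exact congrArg (Quotient.mk _) (meet_comm _ _)
      meet_assoc := by rintro ⟨x⟩ ⟨y⟩ ⟨z⟩; exact congrArg (Quotient.mk _) (meet_assoc _ _ _)
      imp_self := by rintro ⟨x⟩; exact congrArg (Quotient.mk _) (HeytingSemilattice.imp_self _)
      meet_imp := by rintro ⟨x⟩ ⟨y⟩; exact congrArg (Quotient.mk _) (meet_imp _ _)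
      meet_imp_right := by rintro ⟨x⟩ ⟨y⟩; exact congrArg (Quotient.mk _) (meet_imp_right _ _)
      imp_meet := by rintro ⟨x⟩ ⟨y⟩ ⟨z⟩; exact congrArg (Quotient.mk _) (imp_meet _ _ _) }

/-- The quotient morphism. -/
def Congruence.proj (R : Congruence A) : A ⟶ R.quotient :=
  Hom.mk (Quotient.mk R.toSetoid) rfl (fun _ _ => rfl) (fun _ _ => rfl)

theorem Congruence.proj_surjective (R : Congruence A) : Function.Surjective R.proj.toFun :=
  Quotient.mk_surjective

theorem Congruence.proj_eq_iff (R : Congruence A) {a b : A.carrier} :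
    R.proj.toFun a = R.proj.toFun b ↔ R.r a b := Quotient.eq

/-- The congruence of a filter. -/
def filterCongruence (F : Sub A) : Congruence A where
  r a b := ∃ d ∈ F.carrier, meet d a = meet d b
  iseqv :=
    { refl := fun a => ⟨one, F.one_mem, rfl⟩
      symm := fun ⟨d, hd, h⟩ => ⟨d, hd, h.symm⟩
      trans := fun {a b c} ⟨d, hd, h⟩ ⟨e, he, h'⟩ => ⟨meet d e, F.meet_mem hd he, by
        rw [meet_comm d e, ← meet_assoc, h, meet_assoc, meet_comm e d, ← meet_assoc, h',
          meet_assoc]⟩ }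
  meet' := fun {a b a' b'} ⟨d, hd, h⟩ ⟨e, he, h'⟩ => ⟨meet d e, F.meet_mem hd he, by
    rw [meet_meet_meet_comm, h, h', meet_meet_meet_comm]⟩
  imp' := fun {a b a' b'} ⟨d, hd, h⟩ ⟨e, he, h'⟩ => ⟨meet d e, F.meet_mem hd he, by
    have h₁ : meet (meet d e) a = meet (meet d e) b := by
      rw [meet_comm d e, ← meet_assoc, h, meet_assoc]
    have h₂ : meet (meet d e) a' = meet (meet d e) b' := by
      rw [← meet_assoc, h', meet_assoc]
    rw [← meet_meet_imp_meet, h₁, h₂, meet_meet_imp_meet]⟩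

/-- The image of a morphism. -/
def range (f : A ⟶ B) : Sub B where
  carrier := Set.range f.toFun
  one_mem := ⟨one, f.map_one⟩
  meet_mem := by rintro _ _ ⟨a, rfl⟩ ⟨b, rfl⟩; exact ⟨_, f.map_meet a b⟩
  imp_mem := by rintro _ _ ⟨a, rfl⟩ ⟨b, rfl⟩; exact ⟨_, f.map_imp a b⟩

/-- Filters are normal subobjects. -/
theorem isNormal_of_upward_closed {K : HSLat.{u}} (k : K ⟶ A) (hk : Function.Injective k.toFun)
    (h : ∀ x a, Le (k.toFun x) a → ∃ y, k.toFun y = a) : SemiAb.IsNormal k := by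
  refine ⟨_, (filterCongruence (range k)).proj, isKernelOf_of_injective hk fun a => ?_⟩
  rw [← Hom.map_one, Congruence.proj_eq_iff]
  constructor
  · rintro ⟨_, ⟨x, rfl⟩, hx⟩
    -- `d ∧ a = d ∧ 1` says that `d ≤ a`.
    exact h x a (hx.trans (meet_one _))
  · rintro ⟨x, rfl⟩
    exact ⟨_, ⟨x, rfl⟩, (meet_self _).trans (meet_one _).symm⟩

theorem upward_closed_of_isKernelOf {K : HSLat.{u}} {k : K ⟶ A} {f : A ⟶ B}
    (h : SemiAb.IsKernelOf k f) {x : K.carrier} {a : A.carrier} (hx : Le (k.toFun x) a) :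
    ∃ y, k.toFun y = a := by
  refine exists_of_isKernelOf h ?_
  have h₁ : f.toFun (k.toFun x) = one := toFun_eq_of_comp_eq h.zero x
  rw [← one_meet (f.toFun a), ← h₁, ← f.map_meet, hx]

/-! ### Regular epimorphisms and exactness -/

/-- A surjective morphism is the coequalizer of any pair which generates its kernel pair. -/
noncomputable def isColimitOfSurjective {R : HSLat.{u}} {r s : R ⟶ A} {q : A ⟶ B}
    (hq : Function.Surjective q.toFun) (w : r ≫ q = s ≫ q)
    (h : ∀ a b, q.toFun a = q.toFun b → ∃ x, r.toFun x = a ∧ s.toFun x = b) :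
    IsColimit (Cofork.ofπ q w) :=
  Cofork.IsColimit.mk _
    (fun t => descOfSurjective q hq t.π fun a b hab => by
      obtain ⟨x, rfl, rfl⟩ := h a b hab
      exact toFun_eq_of_comp_eq t.condition x)
    (fun t => comp_descOfSurjective q hq _ _)
    (fun t m hm => (epi_of_surjective q hq).left_cancellation _ _
      (hm.trans (comp_descOfSurjective q hq _ _).symm))

theorem isRegularEpi_iff_surjective (q : A ⟶ B) :
    IsRegularEpi q ↔ Function.Surjective q.toFun := by
  constructor
  · rintro ⟨⟨h⟩⟩
    have := h.epi
    have hi : Function.Injective (range q).incl.toFun := Subtype.val_injective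
    let e : A ⟶ (range q).toHSLat := (range q).lift q fun a => ⟨a, rfl⟩
    have he : h.left ≫ e = h.right ≫ e :=
      hom_ext fun x => hi (toFun_eq_of_comp_eq h.w x)
    obtain ⟨d, hd⟩ := Cofork.IsColimit.desc' h.isColimit e he
    replace hd : q ≫ d = e := hd
    -- The coequaliser `q` factors through its image, so the inclusion of the image is split epi.
    have hdi : d ≫ (range q).incl = 𝟙 B := by
      rw [← cancel_epi q, ← Category.assoc, hd]
      rfl
    intro b
    obtain ⟨a, ha⟩ := (d.toFun b).2
    exact ⟨a, ha.trans (toFun_eq_of_comp_eq hdi b)⟩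
  · intro hq
    exact ⟨⟨⟨_, _, _, (isPullback_fibreProd q q).w, isColimitOfSurjective hq _ fun a b hab =>
      ⟨⟨(a, b), hab⟩, rfl, rfl⟩⟩⟩⟩

instance : Regular HSLat.{u} where
  toHasFiniteLimits := hasFiniteLimits_of_hasTerminal_and_pullbacks
  hasCoequalizer_of_isKernelPair {X Y Z f r s} h := by
    let e : X ⟶ (range f).toHSLat := (range f).lift f fun a => ⟨a, rfl⟩
    have hq : Function.Surjective e.toFun := by
      rintro ⟨_, a, rfl⟩
      exact ⟨a, rfl⟩
    have hw : r ≫ e = s ≫ e := hom_ext fun x => Subtype.ext (toFun_eq_of_comp_eq h.w x)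
    exact ⟨_, isColimitOfSurjective hq hw fun a b hab =>
      (existsUnique_of_isPullback h (congrArg Subtype.val hab)).exists⟩
  regularEpiIsStableUnderBaseChange.of_isPullback {X Y Y' S f g f' g'} sq hg := by
    rw [MorphismProperty.regularEpi_iff, isRegularEpi_iff_surjective] at *
    intro x
    obtain ⟨y, hy⟩ := hg (f.toFun x)
    obtain ⟨z, hz⟩ := (existsUnique_of_isPullback sq hy).exists
    exact ⟨z, hz.2⟩

/-- Joint monicity kills the subobject of elements sent to `1` by both maps, and `x ⇒ y`, `y ⇒ x`
lie in it. -/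
theorem jointly_injective_of_jointlyMono {R : HSLat.{u}} {r : R ⟶ A} {s : R ⟶ B}
    (h : JointlyMono₂ r s) {x y : R.carrier} (hr : r.toFun x = r.toFun y)
    (hs : s.toFun x = s.toFun y) : x = y := by
  let S : Sub R :=
    { carrier := {x | r.toFun x = one ∧ s.toFun x = one}
      one_mem := ⟨r.map_one, s.map_one⟩
      meet_mem := fun hx hy => ⟨(ker r).meet_mem hx.1 hy.1, (ker s).meet_mem hx.2 hy.2⟩
      imp_mem := fun hx hy => ⟨(ker r).imp_mem hx.1 hy.1, (ker s).imp_mem hx.2 hy.2⟩ }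
  have hS : S.incl = 0 := h.right_cancellation _ _
    (hom_ext fun x => x.2.1.trans r.map_one.symm) (hom_ext fun x => x.2.2.trans s.map_one.symm)
  have key (z : R.carrier) (hz : z ∈ S.carrier) : z = one := congrArg (fun f => f.toFun ⟨z, hz⟩) hS
  refine eq_of_imp_eq_one (key _ ⟨?_, ?_⟩) (key _ ⟨?_, ?_⟩)
  · rw [r.map_imp, hr, HeytingSemilattice.imp_self]
  · rw [s.map_imp, hs, HeytingSemilattice.imp_self]
  · rw [r.map_imp, hr, HeytingSemilattice.imp_self]
  · rw [s.map_imp, hs, HeytingSemilattice.imp_self]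

/-- The congruence of an internal equivalence relation. -/
def congruenceOfEquivalenceRelation {R : HSLat.{u}} {r s : R ⟶ A} (e : EquivalenceRelation r s) :
    Congruence A where
  r a b := ∃ x, r.toFun x = a ∧ s.toFun x = b
  iseqv :=
    { refl := fun a => ⟨e.r.toFun a, toFun_eq_of_comp_eq e.reflexivity₁ a,
        toFun_eq_of_comp_eq e.reflexivity₂ a⟩
      symm := by
        rintro _ _ ⟨x, rfl, rfl⟩
        exact ⟨e.s.toFun x, toFun_eq_of_comp_eq e.symmetry₁ x, toFun_eq_of_comp_eq e.symmetry₂ x⟩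
      trans := by
        rintro _ _ _ ⟨x, rfl, rfl⟩ ⟨y, hy, rfl⟩
        obtain ⟨z, rfl, rfl⟩ :=
          (existsUnique_of_isPullback (IsPullback.of_isLimit e.isLimit) hy.symm).exists
        exact ⟨e.t.toFun z, toFun_eq_of_comp_eq e.transitivity₁ z,
          toFun_eq_of_comp_eq e.transitivity₂ z⟩ }
  meet' := by
    rintro _ _ _ _ ⟨x, rfl, rfl⟩ ⟨y, rfl, rfl⟩
    exact ⟨meet x y, r.map_meet _ _, s.map_meet _ _⟩
  imp' := by
    rintro _ _ _ _ ⟨x, rfl, rfl⟩ ⟨y, rfl, rfl⟩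
    exact ⟨imp x y, r.map_imp _ _, s.map_imp _ _⟩

theorem isEffectiveEquivalenceRelation {R : HSLat.{u}} (r s : R ⟶ A)
    (h : IsEquivalenceRelation r s) : IsEffectiveEquivalenceRelation r s := by
  obtain ⟨⟨e⟩⟩ := h
  let S := congruenceOfEquivalenceRelation e
  have hq := S.proj_surjective
  have w : r ≫ S.proj = s ≫ S.proj := hom_ext fun x => S.proj_eq_iff.2 ⟨x, rfl, rfl⟩
  have hS (a b : A.carrier) (hab : S.proj.toFun a = S.proj.toFun b) :
      ∃ x, r.toFun x = a ∧ s.toFun x = b := S.proj_eq_iff.1 hab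
  refine ⟨⟨⟨e, S.quotient, S.proj, ?_, ?_⟩⟩⟩
  · refine isPullback_of_existsUnique w fun a b hab =>
      existsUnique_of_exists_of_unique (hS a b hab) ?_
    rintro x y ⟨rfl, rfl⟩ ⟨h₁, h₂⟩
    exact jointly_injective_of_jointlyMono e.toJointlyMono₂ h₁.symm h₂.symm
  · refine ⟨⟨w⟩, ⟨PushoutCocone.isColimitAux' _ fun t => ?_⟩⟩
    -- Reflexivity forces the two legs of a cocone to agree, so the pushout is a coequaliser.
    have ht : t.inl = t.inr := by
      rw [← Category.id_comp t.inl, ← e.reflexivity₁, Category.assoc, t.condition,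
        e.reflexivity₂_assoc]
    refine ⟨descOfSurjective S.proj hq t.inl fun a b hab => ?_,
      comp_descOfSurjective S.proj hq _ _, (comp_descOfSurjective S.proj hq _ _).trans ht,
      fun hm _ => (epi_of_surjective S.proj hq).left_cancellation _ _
        (hm.trans (comp_descOfSurjective S.proj hq _ _).symm)⟩
    obtain ⟨x, rfl, rfl⟩ := hS a b hab
    exact (toFun_eq_of_comp_eq t.condition x).trans (by rw [ht]; rfl)

/-! ### Protomodularity -/

theorem protomodular : SemiAb.Protomodular HSLat.{u} := by
  intro E B A A' P P' v α β α' β' f p q p' q' g hβ hβ' hα hf hP hP' hp hq hg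
  have hg := bijective_of_isIso g
  -- Only the fibres over `1` are visible in the pullbacks, through pairs `(a, 1)`; `g` being
  -- bijective makes `f` bijective between these fibres.
  have inj (a : A.carrier) (ha : f.toFun a = one) : a = one := by
    have h₁ : α.toFun a = v.toFun one := by
      rw [← toFun_eq_of_comp_eq hα, ha, α'.map_one, v.map_one]
    obtain ⟨x, rfl, hx⟩ := (existsUnique_of_isPullback hP h₁).exists
    have h₂ : g.toFun x = one := (existsUnique_of_isPullback hP'
      (toFun_eq_of_comp_eq hP'.w one)).unique
      ⟨by rw [toFun_eq_of_comp_eq hp, comp_toFun, ha, p'.map_one],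
        by rw [toFun_eq_of_comp_eq hq, hx, q'.map_one]⟩ ⟨rfl, rfl⟩
    rw [hg.1 (h₂.trans g.map_one.symm), p.map_one]
  have surj (a : A'.carrier) (ha : α'.toFun a = one) : ∃ k, f.toFun k = a := by
    obtain ⟨x, rfl, -⟩ := (existsUnique_of_isPullback hP' (ha.trans v.map_one.symm)).exists
    obtain ⟨y, rfl⟩ := hg.2 x
    exact ⟨p.toFun y, (toFun_eq_of_comp_eq hp y).symm⟩
  refine isIso_of_bijective f ⟨injective_of_imp_eq_one f inj, fun a => ?_⟩
  -- `e` lies in the image of `f` and in the same fibre as `a`, so `a ⇒ e` and `((a ⇒ e) ⇒ e) ⇒ a`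
  -- lie over `1` and have preimages, from which `a` is rebuilt.
  let e := β'.toFun (α'.toFun a)
  have he : α'.toFun e = α'.toFun a := toFun_eq_of_comp_eq hβ' _
  obtain ⟨k, hk⟩ := surj (imp a e) (by rw [α'.map_imp, he, HeytingSemilattice.imp_self])
  obtain ⟨l, hl⟩ := surj (imp (imp (imp a e) e) a) (by
    rw [α'.map_imp, α'.map_imp, α'.map_imp, he, HeytingSemilattice.imp_self, one_imp,
      HeytingSemilattice.imp_self])
  refine ⟨meet (imp k (β.toFun (α'.toFun a))) l, ?_⟩
  rw [f.map_meet, f.map_imp, hk, hl, toFun_eq_of_comp_eq hf]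
  exact meet_imp_imp_imp a e

/-! ### Coproducts -/

/-- Terms in the operations of Heyting semilattices with constants from two sets. -/
inductive CoprodTerm (A B : Type u) : Type u
  | inl (a : A) : CoprodTerm A B
  | inr (b : B) : CoprodTerm A B
  | one : CoprodTerm A B
  | meet (s t : CoprodTerm A B) : CoprodTerm A B
  | imp (s t : CoprodTerm A B) : CoprodTerm A B

/-- The value of a term under a pair of morphisms. -/
def CoprodTerm.eval (f : A ⟶ D) (g : B ⟶ D) : CoprodTerm A.carrier B.carrier → D.carrier
  | .inl a => f.toFun a
  | .inr b => g.toFun b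
  | .one => HeytingSemilattice.one
  | .meet s t => HeytingSemilattice.meet (s.eval f g) (t.eval f g)
  | .imp s t => HeytingSemilattice.imp (s.eval f g) (t.eval f g)

/-- Two terms are identified if they have the same value under all pairs of morphisms. -/
def coprodSetoid (A B : HSLat.{u}) : Setoid (CoprodTerm A.carrier B.carrier) where
  -- The relation is a proposition, so quantifying over all `D` does not raise the universe of the
  -- quotient.
  r s t := ∀ (D : HSLat.{u}) (f : A ⟶ D) (g : B ⟶ D), s.eval f g = t.eval f g
  iseqv := ⟨fun _ _ _ _ => rfl, fun h D f g => (h D f g).symm,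
    fun h h' D f g => (h D f g).trans (h' D f g)⟩

/-- The coproduct of two Heyting semilattices. -/
def coprod (A B : HSLat.{u}) : HSLat.{u} where
  carrier := Quotient (coprodSetoid A B)
  str :=
    { one := Quotient.mk _ .one
      meet := Quotient.map₂ .meet fun _ _ h _ _ h' D f g => congrArg₂ meet (h D f g) (h' D f g)
      imp := Quotient.map₂ .imp fun _ _ h _ _ h' D f g => congrArg₂ imp (h D f g) (h' D f g)
      one_meet := by rintro ⟨x⟩; exact Quotient.sound fun D f g => one_meet _
      meet_self := by rintro ⟨x⟩; exact Quotient.sound fun D f g => meet_self _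
      meet_comm := by rintro ⟨x⟩ ⟨y⟩; exact Quotient.sound fun D f g => meet_comm _ _
      meet_assoc := by rintro ⟨x⟩ ⟨y⟩ ⟨z⟩; exact Quotient.sound fun D f g => meet_assoc _ _ _
      imp_self := by
        rintro ⟨x⟩; exact Quotient.sound fun D f g => HeytingSemilattice.imp_self _
      meet_imp := by rintro ⟨x⟩ ⟨y⟩; exact Quotient.sound fun D f g => meet_imp _ _
      meet_imp_right := by rintro ⟨x⟩ ⟨y⟩; exact Quotient.sound fun D f g => meet_imp_right _ _
      imp_meet := by rintro ⟨x⟩ ⟨y⟩ ⟨z⟩; exact Quotient.sound fun D f g => imp_meet _ _ _ }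

/-- The first injection into the coproduct. -/
def coprodInl (A B : HSLat.{u}) : A ⟶ coprod A B :=
  Hom.mk (fun a => Quotient.mk (coprodSetoid A B) (.inl a))
    (Quotient.sound fun _ f _ => f.map_one) (fun x y => Quotient.sound fun _ f _ => f.map_meet x y)
    (fun x y => Quotient.sound fun _ f _ => f.map_imp x y)

/-- The second injection into the coproduct. -/
def coprodInr (A B : HSLat.{u}) : B ⟶ coprod A B :=
  Hom.mk (fun b => Quotient.mk (coprodSetoid A B) (.inr b))
    (Quotient.sound fun _ _ g => g.map_one) (fun x y => Quotient.sound fun _ _ g => g.map_meet x y)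
    (fun x y => Quotient.sound fun _ _ g => g.map_imp x y)

/-- The morphism from the coproduct induced by a pair of morphisms. -/
def coprodDesc (f : A ⟶ D) (g : B ⟶ D) : coprod A B ⟶ D :=
  Hom.mk (Quotient.lift (fun t => t.eval f g) fun _ _ h => h D f g) rfl
    (by rintro ⟨x⟩ ⟨y⟩; rfl) (by rintro ⟨x⟩ ⟨y⟩; rfl)

theorem coprod_hom_ext {m n : coprod A B ⟶ D} (h₁ : coprodInl A B ≫ m = coprodInl A B ≫ n)
    (h₂ : coprodInr A B ≫ m = coprodInr A B ≫ n) : m = n := by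
  refine hom_ext fun x => ?_
  obtain ⟨t, rfl⟩ := Quotient.mk_surjective x
  induction t with
  | inl a => exact toFun_eq_of_comp_eq h₁ a
  | inr b => exact toFun_eq_of_comp_eq h₂ b
  | one => exact m.map_one.trans n.map_one.symm
  | meet s t hs ht =>
    exact (m.map_meet (Quotient.mk _ s) (Quotient.mk _ t)).trans
      ((congrArg₂ meet hs ht).trans (n.map_meet _ _).symm)
  | imp s t hs ht =>
    exact (m.map_imp (Quotient.mk _ s) (Quotient.mk _ t)).trans
      ((congrArg₂ imp hs ht).trans (n.map_imp _ _).symm)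

instance : HasBinaryCoproducts HSLat.{u} :=
  have {A B : HSLat.{u}} : HasColimit (pair A B) :=
    ⟨_, BinaryCofan.IsColimit.mk (BinaryCofan.mk (coprodInl A B) (coprodInr A B))
      (fun f g => coprodDesc f g) (fun _ _ => rfl) (fun _ _ => rfl)
      (fun _ _ _ h₁ h₂ => coprod_hom_ext h₁ h₂)⟩
  hasBinaryCoproducts_of_hasColimit_pair HSLat.{u}

theorem isSemiAbelian : SemiAb.IsSemiAbelian HSLat.{u} where
  hasZeroObject := inferInstance
  regular := inferInstance
  effective _ _ := isEffectiveEquivalenceRelation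
  protomodular := protomodular
  hasBinaryCoproducts := inferInstance

variable {X : HSLat.{u}}

/-! ### Centralisers -/

/-- The elements `a` with `a ⇒ x = x` for all `x` in a subobject. -/
def centraliser (x : X ⟶ A) : Sub A where
  carrier := {a | ∀ t, imp a (x.toFun t) = x.toFun t}
  one_mem _ := one_imp _
  meet_mem {a b} ha hb t := by rw [meet_imp_imp, hb, ha]
  imp_mem {a b} _ hb t :=
    Le.antisymm (by
      have := imp_le_imp_left (x.toFun t) (le_imp a b)
      rwa [hb t] at this) (le_imp _ _)

theorem mem_centraliser_iff {x : X ⟶ A} {a : A.carrier} :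
    a ∈ (centraliser x).carrier ↔ ∀ t, imp a (x.toFun t) = x.toFun t := Iff.rfl

theorem mem_centraliser_of_le {x : X ⟶ A} {a b : A.carrier} (ha : a ∈ (centraliser x).carrier)
    (h : Le a b) : b ∈ (centraliser x).carrier := fun t =>
  Le.antisymm (by
    have := imp_le_imp_left (x.toFun t) h
    rwa [mem_centraliser_iff.1 ha t] at this) (le_imp _ _)

theorem isNormal_centraliser (x : X ⟶ A) : SemiAb.IsNormal (centraliser x).incl :=
  isNormal_of_upward_closed _ Subtype.val_injective fun z a h =>
    ⟨⟨a, mem_centraliser_of_le z.2 h⟩, rfl⟩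

/-- The defining condition is symmetric when `X` is a filter: `s = (x ⇒ z) ⇒ z` is above `x`, hence
in `X`, so `s = (z ⇒ s)`, which is `1` because `z ≤ s`. Thus `x ⇒ z ≤ z`. -/
theorem imp_eq_of_mem_centraliser {x : X ⟶ A} (hx : ∀ t a, Le (x.toFun t) a → ∃ s, x.toFun s = a)
    {z : A.carrier} (hz : z ∈ (centraliser x).carrier) (t : X.carrier) :
    imp (x.toFun t) z = z := by
  obtain ⟨s, hs⟩ := hx t _ (le_imp_imp (x.toFun t) z)
  refine eq_of_imp_eq_one ?_ (imp_eq_one_iff.2 (le_imp _ _))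
  rw [← hs, ← mem_centraliser_iff.1 hz s, imp_eq_one_iff, hs]
  exact le_imp _ _

/-- The cooperator is `(t, z) ↦ x t ∧ z`, which preserves `⇒` because elements of `X` and of the
centraliser fix each other under `⇒`. Conversely, in a product `(1, b) ⇒ (t, 1) = (t, 1)`, and any
cooperator carries this identity to `A`. -/
theorem isCentraliser_centraliser {x : X ⟶ A}
    (hx : ∀ t a, Le (x.toFun t) a → ∃ s, x.toFun s = a) :
    SemiAb.IsCentraliser x (centraliser x).incl := by
  refine ⟨⟨fun a b h => hom_ext fun e => Subtype.ext (toFun_eq_of_comp_eq h e)⟩, ?_, ?_⟩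
  · let Z := (centraliser x).toHSLat
    let P := prodObj X Z
    let p : P ⟶ X := Hom.mk Prod.fst rfl (fun _ _ => rfl) (fun _ _ => rfl)
    let q : P ⟶ Z := Hom.mk Prod.snd rfl (fun _ _ => rfl) (fun _ _ => rfl)
    let pair {T : HSLat.{u}} (f : T ⟶ X) (g : T ⟶ Z) : T ⟶ P :=
      Hom.mk (fun t => (f.toFun t, g.toFun t)) (Prod.ext f.map_one g.map_one)
        (fun a b => Prod.ext (f.map_meet a b) (g.map_meet a b))
        (fun a b => Prod.ext (f.map_imp a b) (g.map_imp a b))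
    let φ : P ⟶ A := Hom.mk (fun a => meet (x.toFun a.1) a.2.1)
      ((congrArg₂ meet x.map_one rfl).trans (meet_self _))
      (fun a b => (congrArg (meet · _) (x.map_meet a.1 b.1)).trans (meet_meet_meet_comm _ _ _ _))
      (fun a b => by
        have h₁ := mem_centraliser_iff.1 a.2.2 (imp a.1 b.1)
        have h₂ := imp_eq_of_mem_centraliser hx ((centraliser x).imp_mem a.2.2 b.2.2) a.1
        rw [imp_meet, meet_comm (x.toFun a.1), meet_imp_imp a.2.1, ← x.map_imp, h₁,
          meet_comm a.2.1, meet_imp_imp, h₂]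
        rfl)
    exact ⟨P, p, q, pair (𝟙 X) 0, pair 0 (𝟙 Z), φ,
      ⟨BinaryFan.IsLimit.mk _ pair (fun _ _ => rfl) (fun _ _ => rfl)
        fun f g m h₁ h₂ => hom_ext fun t =>
          Prod.ext (toFun_eq_of_comp_eq h₁ t) (toFun_eq_of_comp_eq h₂ t)⟩,
      rfl, rfl, rfl, rfl, hom_ext fun _ => meet_one _,
      hom_ext fun _ => (congrArg (meet · _) x.map_one).trans (one_meet _)⟩
  · rintro Y y - ⟨P, p, q, i, j, φ, ⟨hP⟩, hip, hiq, hjp, hjq, rfl, rfl⟩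
    have ext {a b : P.carrier} (h₁ : p.toFun a = p.toFun b) (h₂ : q.toFun a = q.toFun b) : a = b :=
      jointly_injective_of_jointlyMono
        ⟨fun _ _ _ h h' => BinaryFan.IsLimit.hom_ext hP h h'⟩ h₁ h₂
    refine ⟨(centraliser (i ≫ φ)).lift (j ≫ φ) fun b => mem_centraliser_iff.2 fun t => ?_, rfl⟩
    rw [comp_toFun, comp_toFun, ← φ.map_imp]
    refine congrArg _ (ext ?_ ?_)
    · rw [p.map_imp, toFun_eq_of_comp_eq hjp, zero_toFun, one_imp]
    · rw [q.map_imp, toFun_eq_of_comp_eq hiq, zero_toFun, imp_one]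

theorem hasNormalCentralisers : SemiAb.HasNormalCentralisers HSLat.{u} := by
  rintro X A x ⟨B, f, hf⟩
  have hc := isCentraliser_centraliser fun t a h => upward_closed_of_isKernelOf hf h
  exact ⟨⟨_, _, hc⟩, fun Z z hz => hc.isNormal_of_isNormal hz (isNormal_centraliser x)⟩

/-! ### Subsets of the four-element chain -/

/-- A subset of the four-element chain which contains the top element. -/
def chain (s : Finset (Fin 4)) (hs : 3 ∈ s) : HSLat.{u} :=
  Sub.toHSLat (A := ⟨ULift.{u} (Fin 4)⟩)
    { carrier := {a | a.down ∈ s}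
      one_mem := hs
      meet_mem := fun {x y} hx hy => by
        change min x.down y.down ∈ s
        rcases min_choice x.down y.down with h | h <;> rwa [h]
      imp_mem := fun {x y} _ hy => by
        change (if x.down ≤ y.down then 3 else y.down) ∈ s
        split_ifs
        exacts [hs, hy] }

/-- A morphism between subsets of the four-element chain. -/
def chainHom {s t : Finset (Fin 4)} {hs : 3 ∈ s} {ht : 3 ∈ t} (φ : Fin 4 → Fin 4)
    (hφ : ∀ a ∈ s, φ a ∈ t) (h₁ : φ 3 = 3)
    (h₂ : ∀ a ∈ s, ∀ b ∈ s, φ (meet a b) = meet (φ a) (φ b))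
    (h₃ : ∀ a ∈ s, ∀ b ∈ s, φ (imp a b) = imp (φ a) (φ b)) :
    (chain s hs : HSLat.{u}) ⟶ chain t ht :=
  Hom.mk (fun a => ⟨⟨φ a.1.down⟩, hφ _ a.2⟩) (Subtype.ext (ULift.ext _ _ h₁))
    (fun a b => Subtype.ext (ULift.ext _ _ (h₂ _ a.2 _ b.2)))
    (fun a b => Subtype.ext (ULift.ext _ _ (h₃ _ a.2 _ b.2)))

theorem chain_hom_ext {s t : Finset (Fin 4)} {hs : 3 ∈ s} {ht : 3 ∈ t}
    {f g : (chain s hs : HSLat.{u}) ⟶ chain t ht}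
    (h : ∀ a (ha : a ∈ s), (f.toFun ⟨⟨a⟩, ha⟩).1.down = (g.toFun ⟨⟨a⟩, ha⟩).1.down) : f = g :=
  hom_ext fun a => Subtype.ext (ULift.ext _ _ (h a.1.down a.2))

/-- The split extension of `t ⊆ {0, 1, 3}` by `{2, 3}` with middle object `s = t ∪ {2}`. -/
def chainSplitExt (s t : Finset (Fin 4)) (hs : 2 ∈ s ∧ 3 ∈ s) (ht : 2 ∉ t ∧ 3 ∈ t)
    (hts : ∀ a ∈ t, a ∈ s) (hst : ∀ a ∈ s, (![0, 1, 3, 3] : Fin 4 → Fin 4) a ∈ t) :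
    SemiAb.SplitExt (chain.{u} {2, 3} (by decide)) where
  A := chain s hs.2
  B := chain t ht.2
  κ := chainHom id (by simp [hs]) rfl (fun _ _ _ _ => rfl) (fun _ _ _ _ => rfl)
  -- The quotient by the filter `{2, 3}` sends `2` to the top.
  α := chainHom ![0, 1, 3, 3] hst rfl
    (fun a _ b _ => (by decide : ∀ a b, (![0, 1, 3, 3] : Fin 4 → Fin 4) (meet a b) =
      meet (![0, 1, 3, 3] a) (![0, 1, 3, 3] b)) a b)
    (fun a _ b _ => (by decide : ∀ a b, (![0, 1, 3, 3] : Fin 4 → Fin 4) (imp a b) =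
      imp (![0, 1, 3, 3] a) (![0, 1, 3, 3] b)) a b)
  β := chainHom id hts rfl (fun _ _ _ _ => rfl) (fun _ _ _ _ => rfl)
  section_proj := chain_hom_ext fun a ha =>
    (by decide : ∀ a : Fin 4, a ≠ 2 → (![0, 1, 3, 3] : Fin 4 → Fin 4) a = a) a
      fun h => ht.1 (h ▸ ha)
  isKernel := by
    have key : ∀ a, (![0, 1, 3, 3] : Fin 4 → Fin 4) a = 3 ↔ a ∈ ({2, 3} : Finset (Fin 4)) := by
      decide
    refine isKernelOf_of_injective (fun a b h => ?_) ?_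
    · exact Subtype.ext (ULift.ext _ _ (congrArg (fun x => x.1.down) h))
    · rintro ⟨⟨a⟩, ha⟩
      constructor
      · intro h
        exact ⟨⟨⟨a⟩, (key a).1 (congrArg (fun x => x.1.down) h)⟩, rfl⟩
      · rintro ⟨⟨⟨b⟩, hb⟩, h⟩
        obtain rfl : b = a := congrArg (fun x => x.1.down) h
        exact Subtype.ext (ULift.ext _ _ ((key b).2 hb))

/-- A monotone map which sends `0` to `c ∈ {0, 1}` induces a morphism of split extensions. -/
def chainSplitExtHom (c : Fin 4) (hc : c = 0 ∨ c = 1) :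
    chainSplitExt.{u} {0, 2, 3} {0, 3} (by decide) (by decide) (by decide) (by decide) ⟶
      chainSplitExt {0, 1, 2, 3} {0, 1, 3} (by decide) (by decide) (by decide) (by decide) :=
  SemiAb.SplitExt.Hom.mk
    -- The entry at index `1` is a dummy value, since `1` is not in the source.
    (chainHom ![c, 1, 2, 3] (by decide +revert) rfl (by decide +revert) (by decide +revert))
    (chainHom ![c, 1, 2, 3] (by decide +revert) rfl (by decide +revert) (by decide +revert))
    (chain_hom_ext fun a ha => (by decide +revert :
      ∀ a ∈ ({2, 3} : Finset (Fin 4)), (![c, 1, 2, 3] : Fin 4 → Fin 4) a = a) a ha)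
    (chain_hom_ext fun a ha => (by decide +revert :
      ∀ a ∈ ({0, 2, 3} : Finset (Fin 4)), (![c, 1, 2, 3] : Fin 4 → Fin 4)
        ((![0, 1, 3, 3] : Fin 4 → Fin 4) a) =
        (![0, 1, 3, 3] : Fin 4 → Fin 4) ((![c, 1, 2, 3] : Fin 4 → Fin 4) a)) a ha)
    rfl

theorem not_actionAccessible : ¬ SemiAb.ActionAccessible HSLat.{u} := by
  intro h
  obtain ⟨T, hT, ⟨F⟩⟩ := h _ (chainSplitExt.{u} {0, 1, 2, 3} {0, 1, 3} (by decide) (by decide)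
    (by decide) (by decide))
  let c (a : Fin 4) (ha : a ∈ ({0, 1, 2, 3} : Finset (Fin 4))) :
    (chain.{u} {0, 1, 2, 3} (by decide)).carrier := ⟨⟨a⟩, ha⟩
  have h₀₁ : F.f.toFun (c 0 (by decide)) = F.f.toFun (c 1 (by decide)) :=
    congrArg (fun G : SemiAb.SplitExt.Hom (chainSplitExt.{u} {0, 2, 3} {0, 3} (by decide)
        (by decide) (by decide) (by decide)) T =>
      G.f.toFun (show (chain.{u} {0, 2, 3} (by decide)).carrier from ⟨⟨0⟩, by decide⟩))
      (hT (chainSplitExtHom 0 (.inl rfl) ≫ F) (chainSplitExtHom 1 (.inr rfl) ≫ F))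
  -- In the chain, `1 ⇒ 0` is `0`.
  have h₀ : F.f.toFun (c 0 (by decide)) = one := calc
    _ = imp (F.f.toFun (c 1 (by decide))) (F.f.toFun (c 0 (by decide))) := F.f.map_imp _ _
    _ = one := by rw [h₀₁, HeytingSemilattice.imp_self]
  have h₂ : F.f.toFun (c 2 (by decide)) = one := calc
    _ = meet (F.f.toFun (c 0 (by decide))) (F.f.toFun (c 2 (by decide))) := by rw [h₀, one_meet]
    _ = F.f.toFun (c 0 (by decide)) := (F.f.map_meet _ _).symm
    _ = one := h₀
  have h₃ : T.κ.toFun ⟨⟨2⟩, by decide⟩ = T.κ.toFun one :=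
    (toFun_eq_of_comp_eq F.κ_f _).symm.trans (h₂.trans T.κ.map_one.symm)
  have h₄ := congrArg (fun x => x.1.down) (injective_of_isKernelOf T.isKernel h₃)
  exact absurd h₄ (by decide : (2 : Fin 4) ≠ 3)

/-! ### A subobject without normaliser -/

/-- The subobject `{c, (2, 2), (3, 3)}` of `C₄ × C₄`, where `c ≤ (2, 2)`. -/
def exampleSub (c : Fin 4 × Fin 4) (hc : imp c (2, 2) = (3, 3)) (hc' : imp (2, 2) c = c) :
    Sub exampleA.{u} where
  carrier := {p | p = ⟨c⟩ ∨ p = ⟨(2, 2)⟩ ∨ p = ⟨(3, 3)⟩}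
  one_mem := .inr (.inr rfl)
  meet_mem := by
    have h : ∀ c : Fin 4 × Fin 4, imp c (2, 2) = (3, 3) → imp (2, 2) c = c →
      meet c c = c ∧ meet c (2, 2) = c ∧ meet (2, 2) c = c ∧ meet c (3, 3) = c ∧
        meet (3, 3) c = c := by decide
    obtain ⟨h₁, h₂, h₃, h₄, h₅⟩ := h c hc hc'
    rintro _ _ (rfl | rfl | rfl) (rfl | rfl | rfl)
    exacts [.inl (ULift.ext _ _ h₁), .inl (ULift.ext _ _ h₂), .inl (ULift.ext _ _ h₄),
      .inl (ULift.ext _ _ h₃), .inr (.inl rfl), .inr (.inl rfl), .inl (ULift.ext _ _ h₅),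
      .inr (.inl rfl), .inr (.inr rfl)]
  imp_mem := by
    rintro _ _ (rfl | rfl | rfl) (rfl | rfl | rfl)
    exacts [.inr (.inr (HeytingSemilattice.imp_self _)), .inr (.inr (ULift.ext _ _ hc)),
      .inr (.inr (imp_one _)), .inl (ULift.ext _ _ hc'), .inr (.inr rfl), .inr (.inr rfl),
      .inl (one_imp _), .inr (.inl rfl), .inr (.inr rfl)]

/-- The conditions put both coordinates of `c` in `{0, 1}`, so `c` is not above any element of `X`.
Hence `X` is a filter in `X ∪ {c}`, and maximality puts `c` in the normaliser. -/
theorem exists_hom_of_isNormaliser {N : HSLat.{u}} {n : exampleX.{u}.toHSLat ⟶ N}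
    {m : N ⟶ exampleA} (h : SemiAb.IsNormaliser exampleX.incl n m) (c : Fin 4 × Fin 4)
    (hc : imp c (2, 2) = (3, 3)) (hc' : imp (2, 2) c = c) : ∃ a, m.toFun a = ⟨c⟩ := by
  have hX (p : exampleX.{u}.toHSLat.carrier) : p.1 ∈ (exampleSub c hc hc').carrier := .inr p.2
  obtain ⟨l, -, hl⟩ := h.2.2.2 ((exampleSub c hc hc').lift exampleX.incl hX)
    (exampleSub c hc hc').incl
    (isNormal_of_upward_closed _
      (fun a b hab => Subtype.ext (congrArg (fun p => p.1) hab)) (by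
        rintro ⟨x, hx⟩ ⟨a, rfl | ha⟩ hxa
        · refine ⟨⟨⟨c⟩, ?_⟩, rfl⟩
          have hxa' : meet x.down c = x.down := congrArg (fun y => y.1.down) hxa
          have key : ∀ c : Fin 4 × Fin 4, imp c (2, 2) = (3, 3) → imp (2, 2) c = c →
            meet (2, 2) c ≠ (2, 2) ∧ meet (3, 3) c ≠ (3, 3) := by decide
          obtain rfl | rfl := hx
          exacts [absurd hxa' (key c hc hc').1, absurd hxa' (key c hc hc').2]
        · exact ⟨⟨a, ha⟩, rfl⟩))
    ⟨fun a b hab => hom_ext fun e => Subtype.ext (toFun_eq_of_comp_eq hab e)⟩ rfl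
  exact ⟨l.toFun ⟨⟨c⟩, .inl rfl⟩, toFun_eq_of_comp_eq hl _⟩

theorem not_hasNormaliser : ¬ SemiAb.HasNormaliser (Sub.incl exampleX.{u}) := by
  rintro ⟨N, n, m, h⟩
  obtain ⟨a, ha⟩ := exists_hom_of_isNormaliser h (0, 1) (by decide) (by decide)
  obtain ⟨b, hb⟩ := exists_hom_of_isNormaliser h (1, 0) (by decide) (by decide)
  obtain ⟨⟨B, f, hf⟩, -, hnm, -⟩ := h
  -- `(0, 1) ⇒ (1, 0) = (3, 0)` and `(3, 0) ⇒ (2, 2) = (2, 3)`; being above `(2, 2)`, this would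
  -- have to come from `X`.
  obtain ⟨x, hx⟩ := upward_closed_of_isKernelOf hf
    (le_imp (imp a b) (n.toFun ⟨⟨(2, 2)⟩, .inl rfl⟩))
  have hmx : m.toFun (n.toFun x) = imp (imp ⟨(0, 1)⟩ ⟨(1, 0)⟩) ⟨(2, 2)⟩ := by
    rw [hx, m.map_imp, m.map_imp]
    exact congrArg₂ imp (congrArg₂ imp ha hb) (toFun_eq_of_comp_eq hnm _)
  have hx' : x.1.down = (2, 3) := congrArg ULift.down ((toFun_eq_of_comp_eq hnm x).symm.trans hmx)
  rcases x.2 with h | h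
  · exact absurd (hx'.symm.trans (congrArg ULift.down h)) (by decide)
  · exact absurd (hx'.symm.trans (congrArg ULift.down h)) (by decide)

end HSLat

theorem mainTheorem5 :
    -- `HSLat` is not action accessible
    ¬ SemiAb.ActionAccessible HSLat.{u} ∧
    -- the normaliser of `X = {(2, 2), (3, 3)}` in `A = C₄ × C₄` does not exist
    ¬ SemiAb.HasNormaliser (HSLat.Sub.incl exampleX.{u}) ∧
    -- among semi-abelian categories, action accessibility implies that centralisers of normal
    -- monomorphisms exist and are normal
    (∀ (C : Type v) [Category.{w} C] [HasZeroMorphisms C], SemiAb.IsSemiAbelian C →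
      SemiAb.ActionAccessible C → SemiAb.HasNormalCentralisers C) ∧
    -- and this implication is strict, as witnessed by the semi-abelian category `HSLat`
    (SemiAb.IsSemiAbelian HSLat.{u} ∧ SemiAb.HasNormalCentralisers HSLat.{u} ∧
      ¬ SemiAb.ActionAccessible HSLat.{u}) :=
  ⟨HSLat.not_actionAccessible, HSLat.not_hasNormaliser,
    fun _ _ _ => SemiAb.hasNormalCentralisers_of_actionAccessible, HSLat.isSemiAbelian,
    HSLat.hasNormalCentralisers, HSLat.not_actionAccessible⟩
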